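/- Let $\Gamma$ be a finitely generated group with a finite symmetric generating set $\Sigma$, let $B_r\subseteq\Gamma$ be the ball of radius $r$ around the unit in the Cayley graph of $(\Gamma,\Sigma)$, and let $\mathcal{C}=\{0,1\}^{\mathbb{N}}$ be the Cantor set. A free Cantor action is an action $\alpha:\Gamma\curvearrowright\mathcal{C}$ by homeomorphisms such that $\alpha(\gamma)(x)\neq x$ for all $x\in\mathcal{C}$ and $\gamma\neq e$. For an action $\alpha$ of $\Gamma$ on a space $X$ and a map $\phi:X\to Q$ let $$\mathrm{Conf}_{r,\alpha}(\phi)=\bigl\{\,(\gamma\mapsto\phi(\alpha(\gamma)(x)))\in Q^{B_r} \;:\; x\in X\,\bigr\}.$$ Say that $A\subseteq(\{0,1\}^k)^{B_n}$ is a configuration set of $\alpha$ if $A=\mathrm{Conf}_{n,\alpha}(\phi)$ for some continuous $\phi:X\to\{0,1\}^k$. A free Cantor action $\alpha$ qualitatively weakly contains a free Cantor action $\beta$ if for every finite (discrete) set $Q$, every continuous $\psi:\mathcal{C}\to Q$ and every integer $r>0$ there is a continuous $\phi:\mathcal{C}\to Q$ with $\mathrm{Conf}_{r,\alpha}(\phi)=\mathrm{Conf}_{r,\beta}(\psi)$;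 the two actions are qualitatively weakly equivalent if each weakly contains the other. Let $\mathrm{Free}(\Gamma)$ be the set of qualitative weak equivalence classes of free Cantor actions of $\Gamma$, with the metric $d_w$ given by $d_w([\alpha],[\beta])=2^{-n}$, where $n\geq 1$ is the smallest integer for which $\alpha$ and $\beta$ do not have the same configuration sets $A\subseteq(\{0,1\}^n)^{B_n}$, and $d_w([\alpha],[\beta])=0$ if there is no such $n$. Then $\mathrm{Free}(\Gamma)$ is compact with respect to $d_w$. Moreover, let $\alpha_1,\alpha_2,\dots$ be free Cantor actions of $\Gamma$ whose classes form a $d_w$-Cauchy sequence. Then there is a Cantor subshift $Y$, that is, a closed subset $Y\subseteq\mathcal{C}^\Gamma$, invariant under the shift $(\delta\cdot y)(\gamma)=y(\gamma\delta)$, homeomorphic to $\mathcal{C}$, and on which the shift action is free, such that $\lim_j[\alpha_j]$ exists and is the class of the shift action on $Y$ (transported to $\mathcal{C}$ by a homeomorphism), and such that for all $n,k\geq 1$ a set $A\subseteq(\{0,1\}^k)^{B_n}$ is a configuration set of $Y$ if and only if it is a configuration set of $\alpha_j$ for all but finitely many $j$. -/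

import Mathlib

open Filter Topology

namespace QualWeak

/-- The Cantor set `{0,1}^ℕ`. -/
abbrev Cantor : Type := ℕ → Bool

/-- A free action of `Γ` on the Cantor set by homeomorphisms: only the unit has a fixed point. -/
structure FreeCantorAction (Γ : Type*) [Group Γ] where
  act : Γ →* (Cantor ≃ₜ Cantor)
  free : ∀ (γ : Γ) (x : Cantor), act γ x = x → γ = 1

section Conf

variable {Γ : Type*} [Group Γ]

/-- The ball of radius `r` around the unit in the Cayley graph of `Γ` with respect to `S`. -/
def ball (S : Finset Γ) (r : ℕ) : Set Γ :=
  {γ | ∃ l : List Γ, l.length ≤ r ∧ (∀ s ∈ l, s ∈ S) ∧ l.prod = γ}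

theorem one_mem_ball (S : Finset Γ) (r : ℕ) : (1 : Γ) ∈ ball S r :=
  ⟨[], by simp, by simp, by simp⟩

theorem ball_mono (S : Finset Γ) {m n : ℕ} (h : m ≤ n) : ball S m ⊆ ball S n := by
  rintro γ ⟨l, hl, hs, hp⟩
  exact ⟨l, hl.trans h, hs, hp⟩

/-- The pattern `γ ↦ φ (γ · x)` on the ball of radius `r`, for a `Γ`-action `a` on `X`
and a labelling `φ : X → Q`. -/
def pattern (S : Finset Γ) {X Q : Type*} (a : Γ → X → X) (r : ℕ) (φ : X → Q) (x : X) :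
    ball S r → Q :=
  fun γ => φ (a γ x)

/-- The set `Conf_r(φ)` of all patterns of radius `r` that occur in the labelling `φ`. -/
def Conf (S : Finset Γ) {X Q : Type*} (a : Γ → X → X) (r : ℕ) (φ : X → Q) :
    Set (ball S r → Q) :=
  Set.range (pattern S a r φ)

/-- The sets of patterns `A ⊆ ({0,1}^k)^{B_r}` that are of the form `A = Conf_r(φ)` for a
continuous `φ : X → {0,1}^k`. -/
def ConfFamily (S : Finset Γ) {X : Type*} [TopologicalSpace X] (a : Γ → X → X) (r k : ℕ) :
    Set (Set (ball S r → (Fin k → Bool))) :=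
  {A | ∃ φ : X → (Fin k → Bool), Continuous φ ∧ Conf S a r φ = A}

theorem conf_comp (S : Finset Γ) {X Q Q' : Type*} (a : Γ → X → X) {m n : ℕ} (h : m ≤ n)
    (φ : X → Q) (g : Q → Q') :
    Conf S a m (g ∘ φ) =
      (fun (τ : ball S n → Q) (γ : ball S m) => g (τ ⟨γ.1, ball_mono S h γ.2⟩)) ''
        Conf S a n φ := by
  unfold Conf
  rw [← Set.range_comp]
  rfl

end Conf

namespace FreeCantorAction

variable {Γ : Type*} [Group Γ]

/-- The action as a map `Γ → Cantor → Cantor`. -/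
def map (α : FreeCantorAction Γ) (γ : Γ) (x : Cantor) : Cantor := α.act γ x

/-- `α` qualitatively weakly contains `β`. -/
def WeaklyContains (S : Finset Γ) (α β : FreeCantorAction Γ) : Prop :=
  ∀ (Q : Type) [Finite Q] [TopologicalSpace Q] [DiscreteTopology Q] (ψ : Cantor → Q),
    Continuous ψ → ∀ r : ℕ, 0 < r →
      ∃ φ : Cantor → Q, Continuous φ ∧ Conf S α.map r φ = Conf S β.map r ψ

/-- `α` and `β` are qualitatively weakly equivalent. -/
def WeaklyEquiv (S : Finset Γ) (α β : FreeCantorAction Γ) : Prop :=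
  WeaklyContains S α β ∧ WeaklyContains S β α

theorem WeaklyContains.refl (S : Finset Γ) (α : FreeCantorAction Γ) : WeaklyContains S α α :=
  fun _ _ _ _ ψ hψ _ _ => ⟨ψ, hψ, rfl⟩

theorem WeaklyContains.trans {S : Finset Γ} {α β δ : FreeCantorAction Γ}
    (h₁ : WeaklyContains S α β) (h₂ : WeaklyContains S β δ) : WeaklyContains S α δ := by
  intro Q _ _ _ ψ hψ r hr
  obtain ⟨φ, hφ, e⟩ := h₂ Q ψ hψ r hr
  obtain ⟨χ, hχ, e'⟩ := h₁ Q φ hφ r hr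
  exact ⟨χ, hχ, e'.trans e⟩

/-- Qualitative weak equivalence as an equivalence relation. -/
def weakSetoid (S : Finset Γ) : Setoid (FreeCantorAction Γ) where
  r := WeaklyEquiv S
  iseqv :=
    ⟨fun α => ⟨.refl S α, .refl S α⟩, fun h => ⟨h.2, h.1⟩,
      fun h₁ h₂ => ⟨h₁.1.trans h₂.1, h₂.2.trans h₁.2⟩⟩

theorem WeaklyContains.confFamily_subset {S : Finset Γ} {α β : FreeCantorAction Γ}
    (h : WeaklyContains S α β) {r : ℕ} (hr : 1 ≤ r) (k : ℕ) :
    ConfFamily S β.map r k ⊆ ConfFamily S α.map r k := by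
  rintro A ⟨ψ, hψ, rfl⟩
  exact h (Fin k → Bool) ψ hψ r hr

theorem WeaklyEquiv.confFamily_eq {S : Finset Γ} {α β : FreeCantorAction Γ}
    (h : WeaklyEquiv S α β) {r : ℕ} (hr : 1 ≤ r) (k : ℕ) :
    ConfFamily S α.map r k = ConfFamily S β.map r k :=
  (h.2.confFamily_subset hr k).antisymm (h.1.confFamily_subset hr k)

theorem weaklyContains_of_confFamily {S : Finset Γ} {α β : FreeCantorAction Γ}
    (h : ∀ n, 1 ≤ n → ConfFamily S β.map n n ⊆ ConfFamily S α.map n n) :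
    WeaklyContains S α β := by
  intro Q _ _ _ ψ hψ r hr
  have : Nonempty Q := ⟨ψ fun _ => false⟩
  classical
  have := Fintype.ofFinite Q
  set n := max r (Fintype.card Q) with hn
  have hrn : r ≤ n := le_max_left _ _
  obtain ⟨e⟩ : Nonempty (Q ↪ (Fin n → Bool)) := by
    rw [Function.Embedding.nonempty_iff_card_le]
    have h1 : Fintype.card Q ≤ n := le_max_right _ _
    have h2 : n < 2 ^ n := Nat.lt_two_pow_self
    simp only [Fintype.card_pi, Fintype.card_bool, Finset.prod_const, Finset.card_univ,
      Fintype.card_fin]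
    omega
  obtain ⟨φ', hφ', hc⟩ := h n (hr.trans_le hrn)
    ⟨e ∘ ψ, (continuous_of_discreteTopology (f := e)).comp hψ, rfl⟩
  let g : (Fin n → Bool) → Q := Function.invFun e
  have hg : ∀ q, g (e q) = q := Function.leftInverse_invFun e.injective
  refine ⟨g ∘ φ', (continuous_of_discreteTopology (f := g)).comp hφ', ?_⟩
  have hψe : ψ = g ∘ (e ∘ ψ) := by
    funext x
    simp [hg]
  rw [conf_comp S α.map hrn φ' g, hc, ← conf_comp S β.map hrn (e ∘ ψ) g, ← hψe]

/-- The indices `n ≥ 1` at which the families of sets of patterns of `α` and `β` in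
`({0,1}^n)^{B_n}` differ. -/
def diffSet (S : Finset Γ) (α β : FreeCantorAction Γ) : Set ℕ :=
  {n | 1 ≤ n ∧ ConfFamily S α.map n n ≠ ConfFamily S β.map n n}

open Classical in
/-- The weak distance of two free Cantor actions: `2^{-n}` for the smallest `n ≥ 1` at which
they differ, and `0` if they do not differ. -/
noncomputable def weakDist (S : Finset Γ) (α β : FreeCantorAction Γ) : ℝ :=
  if (diffSet S α β).Nonempty then (1 / 2 : ℝ) ^ sInf (diffSet S α β) else 0

theorem weakDist_nonneg (S : Finset Γ) (α β : FreeCantorAction Γ) : 0 ≤ weakDist S α β := by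
  unfold weakDist
  split_ifs <;> positivity

theorem weakDist_comm (S : Finset Γ) (α β : FreeCantorAction Γ) :
    weakDist S α β = weakDist S β α := by
  have : diffSet S α β = diffSet S β α := by
    ext n
    simp only [diffSet, Set.mem_ofPred_eq, ne_comm]
  unfold weakDist
  rw [this]

theorem le_weakDist {S : Finset Γ} {α β : FreeCantorAction Γ} {n : ℕ}
    (h : n ∈ diffSet S α β) : (1 / 2 : ℝ) ^ n ≤ weakDist S α β := by
  rw [weakDist, if_pos ⟨n, h⟩]
  exact pow_le_pow_of_le_one (by norm_num) (by norm_num) (Nat.sInf_le h)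

theorem weakDist_triangle (S : Finset Γ) (α β δ : FreeCantorAction Γ) :
    weakDist S α δ ≤ weakDist S α β + weakDist S β δ := by
  have h₁ := weakDist_nonneg S α β
  have h₂ := weakDist_nonneg S β δ
  by_cases hne : (diffSet S α δ).Nonempty
  · have hm := Nat.sInf_mem hne
    have he : weakDist S α δ = (1 / 2 : ℝ) ^ sInf (diffSet S α δ) := if_pos hne
    by_cases hb : ConfFamily S α.map (sInf (diffSet S α δ)) (sInf (diffSet S α δ)) =
        ConfFamily S β.map (sInf (diffSet S α δ)) (sInf (diffSet S α δ))
    · have := le_weakDist (S := S) (α := β) (β := δ) ⟨hm.1, hb ▸ hm.2⟩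
      linarith
    · have := le_weakDist (S := S) (α := α) (β := β) ⟨hm.1, hb⟩
      linarith
  · have he : weakDist S α δ = 0 := if_neg hne
    linarith

theorem weaklyEquiv_of_weakDist_eq_zero {S : Finset Γ} {α β : FreeCantorAction Γ}
    (h : weakDist S α β = 0) : WeaklyEquiv S α β := by
  have key : ∀ n, 1 ≤ n → ConfFamily S α.map n n = ConfFamily S β.map n n := by
    intro n hn
    by_contra hne
    have h₁ := le_weakDist (S := S) (α := α) (β := β) ⟨hn, hne⟩
    have h₂ : (0 : ℝ) < (1 / 2 : ℝ) ^ n := by positivity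
    linarith
  exact ⟨weaklyContains_of_confFamily fun n hn => (key n hn).ge,
    weaklyContains_of_confFamily fun n hn => (key n hn).le⟩

theorem weakDist_self (S : Finset Γ) (α : FreeCantorAction Γ) : weakDist S α α = 0 :=
  if_neg fun ⟨_, hn⟩ => hn.2 rfl

theorem weakDist_congr {S : Finset Γ} {α β α' β' : FreeCantorAction Γ}
    (h₁ : WeaklyEquiv S α α') (h₂ : WeaklyEquiv S β β') :
    weakDist S α β = weakDist S α' β' := by
  have : diffSet S α β = diffSet S α' β' := by
    ext n
    simp only [diffSet, Set.mem_ofPred_eq]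
    refine and_congr_right fun hn => ?_
    rw [h₁.confFamily_eq hn, h₂.confFamily_eq hn]
  unfold weakDist
  rw [this]

end FreeCantorAction

open FreeCantorAction

/-- The set `Free(Γ)` of qualitative weak equivalence classes of free Cantor actions of `Γ`
(with respect to the generating set `S`). -/
def Free {Γ : Type*} [Group Γ] (S : Finset Γ) : Type _ := Quotient (weakSetoid S)

section Space

variable {Γ : Type*} [Group Γ]

/-- The class of a free Cantor action. -/
def cls (S : Finset Γ) (α : FreeCantorAction Γ) : Free S := Quotient.mk (weakSetoid S) α

/-- The weak distance of two classes. -/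
noncomputable def dw (S : Finset Γ) : Free S → Free S → ℝ :=
  Quotient.lift₂ (weakDist S) fun _ _ _ _ h₁ h₂ => weakDist_congr h₁ h₂

/-- `Free(Γ)` with the metric `dw`. -/
noncomputable instance freeMetricSpace (S : Finset Γ) : MetricSpace (Free S) where
  dist := dw S
  dist_self x := by
    induction x using Quotient.inductionOn
    exact weakDist_self S _
  dist_comm x y := by
    induction x, y using Quotient.inductionOn₂
    exact weakDist_comm S _ _
  dist_triangle x y z := by
    induction x, y, z using Quotient.inductionOn₃
    exact weakDist_triangle S _ _ _
  eq_of_dist_eq_zero {x y} h := by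
    induction x, y using Quotient.inductionOn₂
    exact Quotient.sound (s := weakSetoid S) (weaklyEquiv_of_weakDist_eq_zero h)

/-- The shift action of `Γ` on `Cantor^Γ`. -/
def shift (δ : Γ) (y : Γ → Cantor) : Γ → Cantor := fun γ => y (γ * δ)

/-- Cantor subshifts: closed shift-invariant subsets of `Cantor^Γ` that are homeomorphic to the
Cantor set and on which the shift action is free. -/
structure CantorSubshift (Γ : Type*) [Group Γ] where
  carrier : Set (Γ → Cantor)
  isClosed : IsClosed carrier
  shift_mem : ∀ (δ : Γ), ∀ y ∈ carrier, shift δ y ∈ carrier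
  homeo : Nonempty (carrier ≃ₜ Cantor)
  free : ∀ (δ : Γ), ∀ y ∈ carrier, shift δ y = y → δ = 1

/-- The shift action restricted to a Cantor subshift. -/
def CantorSubshift.map (Y : CantorSubshift Γ) (δ : Γ) (y : Y.carrier) : Y.carrier :=
  ⟨shift δ y.1, Y.shift_mem δ y.1 y.2⟩

/-- The free Cantor action `α` is conjugate to the shift action on `Y`. -/
def CantorSubshift.IsConj (Y : CantorSubshift Γ) (α : FreeCantorAction Γ) : Prop :=
  ∃ h : Y.carrier ≃ₜ Cantor, ∀ (δ : Γ) (y : Y.carrier), h (Y.map δ y) = α.map δ (h y)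

/-- A set `A` of patterns is surviving for a sequence of free Cantor actions if it is of the form
`Conf_n(φ_j)`, with `φ_j` continuous, for all but finitely many members of the sequence. -/
def Surviving (S : Finset Γ) (α : ℕ → FreeCantorAction Γ) (n k : ℕ)
    (A : Set (ball S n → (Fin k → Bool))) : Prop :=
  ∀ᶠ j in atTop, A ∈ ConfFamily S (α j).map n k

end Space

end QualWeak

/-! For each level `N` there are only finitely many possible families of configuration sets, and
sharing the family at level `N` means distance below `2^{-N}`; so `Free S` is totally bounded, and
compactness reduces to the existence of limits of Cauchy sequences.

For the limit, each `α j` gets one Cantor-valued labelling `Φ j` whose even coordinates list the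
bits of labellings realizing every configuration set of `α j`. The orbits read through `Φ j` form a
subshift of `Cantor^Γ`, and the limit `Y` of these subshifts along a nonprincipal ultrafilter is
again closed and invariant. By compactness a finite-valued continuous map has the same image on `Y`
as on almost all of the subshifts (`image_limSet_eventuallyEq`). Hence a surviving set is realized
on `Y` by reading off even coordinates. Conversely, a labelling of `Y` extends to `Cantor^Γ` along a
retraction and pulls back to almost all `α j`; the Cauchy property turns "infinitely many" into "all
but finitely many".

The odd coordinates of `Φ j` split every basic neighbourhood, so `Y` has no isolated points and is a
Cantor set (`nonempty_homeomorph_cantor`). Freeness is visible in configuration sets: a fixed point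
free homeomorphism has a continuous 4-colouring separating each point from its image
(`exists_coloring`), and the patterns of that colouring survive on `Y`. -/

namespace QualWeak

/-! ### Perfect closed subsets of the Cantor set -/

section CantorTopology

theorem cylinder_mem_nhds (x : ℕ → Bool) (n : ℕ) : {y : ℕ → Bool | ∀ i < n, y i = x i} ∈ 𝓝 x :=
  (PiNat.isOpen_cylinder (fun _ => Bool) x n).mem_nhds (PiNat.self_mem_cylinder x n)

theorem exists_cylinder_subset {x : ℕ → Bool} {V : Set (ℕ → Bool)} (hV : V ∈ 𝓝 x) :
    ∃ n, ∀ y : ℕ → Bool, (∀ i < n, y i = x i) → y ∈ V := by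
  obtain ⟨t, ⟨z, n, rfl⟩, hx, ht⟩ :=
    (PiNat.isTopologicalBasis_cylinders (fun _ => Bool)).mem_nhds_iff.1 hV
  refine ⟨n, fun y hy => ht ?_⟩
  rw [← PiNat.mem_cylinder_iff_eq.1 hx]
  exact hy

/-- `x` and some element of `K` branch off exactly at position `n`. -/
def SplitsAt (K : Set (ℕ → Bool)) (x : ℕ → Bool) (n : ℕ) : Prop :=
  ∃ y ∈ K, (∀ i < n, y i = x i) ∧ y n ≠ x n

variable {K : Set (ℕ → Bool)}

/-- If `x'` already differs from `x` at `n`, then `x` itself is the witness for `x'`; otherwise the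
old witness still works. -/
theorem SplitsAt.congr {x x' : ℕ → Bool} (hx : x ∈ K) {n : ℕ} (h : ∀ i < n, x' i = x i)
    (hs : SplitsAt K x n) : SplitsAt K x' n := by
  obtain ⟨y, hy, hyx, hn⟩ := hs
  by_cases hxx : x' n = x n
  · exact ⟨y, hy, fun i hi => (hyx i hi).trans (h i hi).symm, hxx ▸ hn⟩
  · exact ⟨x, hx, fun i hi => (h i hi).symm, fun e => hxx e.symm⟩

theorem splitsAt_congr {x x' : ℕ → Bool} (hx : x ∈ K) (hx' : x' ∈ K) {n : ℕ}
    (h : ∀ i < n, x' i = x i) : SplitsAt K x n ↔ SplitsAt K x' n :=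
  ⟨fun hs => hs.congr hx h, fun hs => hs.congr hx' fun i hi => (h i hi).symm⟩

-- Branching at a position depends only on the bits before it, so points agreeing below `n` have the
-- same branching positions below `n`, and `n` has the same index for both.
open Classical in
theorem nth_splitsAt_congr {x x' : ℕ → Bool} (hx : x ∈ K) (hx' : x' ∈ K) {n : ℕ}
    (h : ∀ i < n, x' i = x i) (hs : SplitsAt K x n) :
    Nat.nth (SplitsAt K x) (Nat.count (SplitsAt K x) n) = n ∧
      Nat.nth (SplitsAt K x') (Nat.count (SplitsAt K x) n) = n := by
  have hc : Nat.count (SplitsAt K x) n = Nat.count (SplitsAt K x') n := by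
    rw [Nat.count_eq_card_filter_range, Nat.count_eq_card_filter_range]
    congr 1
    refine Finset.filter_congr fun m hm => splitsAt_congr hx hx' fun i hi => h i ?_
    exact hi.trans (Finset.mem_range.1 hm)
  refine ⟨Nat.nth_count hs, ?_⟩
  rw [hc]
  exact Nat.nth_count (hs.congr hx h)

/-- The bits of `x` at the positions where it branches off from other elements of `K`. -/
noncomputable def branchCode (K : Set (ℕ → Bool)) (x : ℕ → Bool) (m : ℕ) : Bool :=
  x (Nat.nth (SplitsAt K x) m)

theorem infinite_splitsAt (hK : ∀ x ∈ K, ∀ n, ∃ y ∈ K, y ≠ x ∧ ∀ i < n, y i = x i)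
    {x : ℕ → Bool} (hx : x ∈ K) : {n | SplitsAt K x n}.Infinite := by
  refine Nat.frequently_atTop_iff_infinite.1 (frequently_atTop.2 fun n => ?_)
  obtain ⟨y, hy, hne, hyx⟩ := hK x hx n
  refine ⟨PiNat.firstDiff y x, ?_, y, hy, fun i hi => PiNat.apply_eq_of_lt_firstDiff hi,
    PiNat.apply_firstDiff_ne hne⟩
  by_contra hlt
  exact PiNat.apply_firstDiff_ne hne (hyx _ (not_le.1 hlt))

open Classical in
theorem nth_splitsAt_eq (hK : ∀ x ∈ K, ∀ n, ∃ y ∈ K, y ≠ x ∧ ∀ i < n, y i = x i)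
    {x x' : ℕ → Bool} (hx : x ∈ K) (hx' : x' ∈ K) {m : ℕ}
    (h : ∀ i < Nat.nth (SplitsAt K x) m, x' i = x i) :
    Nat.nth (SplitsAt K x') m = Nat.nth (SplitsAt K x) m := by
  have hinf := infinite_splitsAt hK hx
  have := (nth_splitsAt_congr hx hx' h (Nat.nth_mem_of_infinite hinf m)).2
  rwa [Nat.count_nth_of_infinite hinf] at this

theorem continuous_branchCode (hK : ∀ x ∈ K, ∀ n, ∃ y ∈ K, y ≠ x ∧ ∀ i < n, y i = x i) :
    Continuous fun x : K => branchCode K x := by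
  refine continuous_pi fun m => IsLocallyConstant.continuous ?_
  rw [IsLocallyConstant.iff_eventually_eq]
  rintro ⟨x, hx⟩
  have := continuous_subtype_val.continuousAt (x := (⟨x, hx⟩ : K))
    (cylinder_mem_nhds x (Nat.nth (SplitsAt K x) m + 1))
  filter_upwards [this] with ⟨y, hy⟩ hyx
  replace hyx : ∀ i < Nat.nth (SplitsAt K x) m + 1, y i = x i := hyx
  have e := nth_splitsAt_eq hK hx hy fun i hi => hyx i (hi.trans (Nat.lt_succ_self _))
  simp only [branchCode, e]
  exact hyx _ (Nat.lt_succ_self _)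

/-- The first difference of two points of `K` is a branching position of both, with the same index,
so the codes differ there. -/
theorem injective_branchCode : Function.Injective fun x : K => branchCode K x := by
  classical
  rintro ⟨x, hx⟩ ⟨y, hy⟩ h
  by_contra hne
  replace hne : x ≠ y := fun e => hne (Subtype.ext e)
  have hs : SplitsAt K x (PiNat.firstDiff x y) :=
    ⟨y, hy, fun i hi => (PiNat.apply_eq_of_lt_firstDiff hi).symm,
      (PiNat.apply_firstDiff_ne hne).symm⟩
  obtain ⟨e₁, e₂⟩ := nth_splitsAt_congr hx hy
    (fun i hi => (PiNat.apply_eq_of_lt_firstDiff hi).symm) hs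
  have := congrFun h (Nat.count (SplitsAt K x) (PiNat.firstDiff x y))
  simp only [branchCode, e₁, e₂] at this
  exact PiNat.apply_firstDiff_ne hne this

/-- Density of the image, by correcting one bit at a time: if bit `m` is wrong, move to a point of
`K` that branches off exactly there. Earlier code bits are kept, and the new bit is right because
there are only two values. -/
theorem exists_branchCode_eq (hK : ∀ x ∈ K, ∀ n, ∃ y ∈ K, y ≠ x ∧ ∀ i < n, y i = x i)
    (hne : K.Nonempty) (z : ℕ → Bool) (m : ℕ) : ∃ x ∈ K, ∀ i < m, branchCode K x i = z i := by
  induction m with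
  | zero => exact ⟨hne.some, hne.some_mem, by simp⟩
  | succ m ih =>
    obtain ⟨x, hx, hxz⟩ := ih
    have hinf := infinite_splitsAt hK hx
    by_cases hm : branchCode K x m = z m
    · refine ⟨x, hx, fun i hi => ?_⟩
      rcases Nat.lt_succ_iff_lt_or_eq.1 hi with h | rfl
      exacts [hxz i h, hm]
    · obtain ⟨y, hy, hyx, hyn⟩ := Nat.nth_mem_of_infinite hinf m
      have hlt : ∀ {i}, i < m → Nat.nth (SplitsAt K x) i < Nat.nth (SplitsAt K x) m :=
        fun hi => Nat.nth_strictMono hinf hi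
      refine ⟨y, hy, fun i hi => ?_⟩
      rcases Nat.lt_succ_iff_lt_or_eq.1 hi with h | rfl
      · rw [← hxz i h, branchCode, nth_splitsAt_eq hK hx hy fun l hl => hyx l (hl.trans (hlt h)),
          hyx _ (hlt h), branchCode]
      · rw [branchCode, nth_splitsAt_eq hK hx hy hyx]
        unfold branchCode at hm
        revert hm hyn
        generalize y _ = a, x _ = b, z _ = c
        revert a b c
        decide

/-- A nonempty closed subset of `{0,1}^ℕ` without isolated points is homeomorphic
to `{0,1}^ℕ`. -/
theorem nonempty_homeomorph_cantor (hcl : IsClosed K) (hne : K.Nonempty)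
    (hK : ∀ x ∈ K, ∀ n, ∃ y ∈ K, y ≠ x ∧ ∀ i < n, y i = x i) : Nonempty (K ≃ₜ (ℕ → Bool)) := by
  have : CompactSpace K := isCompact_iff_compactSpace.1 hcl.isCompact
  have hcont := continuous_branchCode hK
  have hsurj : Function.Surjective fun x : K => branchCode K x := by
    intro z
    have hr : IsClosed (Set.range fun x : K => branchCode K x) :=
      (isCompact_range hcont).isClosed
    change z ∈ Set.range fun x : K => branchCode K x
    rw [← hr.closure_eq, mem_closure_iff_nhds]
    intro V hV
    obtain ⟨n, hn⟩ := exists_cylinder_subset hV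
    obtain ⟨x, hx, hxz⟩ := exists_branchCode_eq hK hne z n
    exact ⟨_, hn _ hxz, ⟨x, hx⟩, rfl⟩
  exact ⟨Continuous.homeoOfEquivCompactToT2
    (f := Equiv.ofBijective _ ⟨injective_branchCode, hsurj⟩) hcont⟩

end CantorTopology

/-! ### Transfer to countable powers of the Cantor set -/

section PowerCantor

/-- A countable power of the Cantor set is homeomorphic to the Cantor set. -/
theorem nonempty_pi_homeomorph_cantor (Γ : Type*) [Countable Γ] [Nonempty Γ] :
    Nonempty ((Γ → Cantor) ≃ₜ Cantor) := by
  obtain ⟨e⟩ : Nonempty (ℕ ≃ Γ × ℕ) := ⟨(nonempty_denumerable _).some.eqv.symm⟩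
  exact ⟨{
    toFun := fun y n => y (e n).1 (e n).2
    invFun := fun x γ i => x (e.symm (γ, i))
    left_inv := fun y => by funext γ i; simp
    right_inv := fun x => by funext n; simp
    continuous_toFun := by fun_prop
    continuous_invFun := by fun_prop }⟩

variable {Γ : Type*} [Countable Γ] [Nonempty Γ] {K : Set (Γ → Cantor)}

theorem nonempty_homeomorph_cantor_of_pi (hcl : IsClosed K) (hne : K.Nonempty)
    (hK : ∀ y ∈ K, ∀ V ∈ 𝓝 y, ∃ z ∈ K, z ≠ y ∧ z ∈ V) : Nonempty (K ≃ₜ Cantor) := by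
  obtain ⟨e⟩ := nonempty_pi_homeomorph_cantor Γ
  obtain ⟨f⟩ := nonempty_homeomorph_cantor (K := e '' K) (e.isClosed_image.2 hcl) (hne.image e) (by
    rintro _ ⟨y, hy, rfl⟩ n
    obtain ⟨z, hz, hzy, hzV⟩ := hK y hy _ (e.continuous.continuousAt (cylinder_mem_nhds (e y) n))
    exact ⟨e z, ⟨z, hz, rfl⟩, fun h => hzy (e.injective h), hzV⟩)
  exact ⟨(e.image K).trans f⟩

theorem exists_retraction_of_pi (hcl : IsClosed K) (hne : K.Nonempty) :
    ∃ r : (Γ → Cantor) → K, Continuous r ∧ ∀ y : K, r y = y := by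
  obtain ⟨e⟩ := nonempty_pi_homeomorph_cantor Γ
  obtain ⟨f, hf, hr, hc⟩ := PiNat.exists_retraction_of_isClosed (E := fun _ => Bool)
    (e.isClosed_image.2 hcl) (hne.image e)
  have hmem : ∀ y, e.symm (f (e y)) ∈ K := by
    intro y
    obtain ⟨z, hz, hze⟩ : f (e y) ∈ e '' K := hr ▸ Set.mem_range_self _
    rw [← hze, e.symm_apply_apply]
    exact hz
  refine ⟨fun y => ⟨e.symm (f (e y)), hmem y⟩, by fun_prop, fun y => Subtype.ext ?_⟩
  simp [hf (e y) ⟨y, y.2, rfl⟩]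

end PowerCantor

/-! ### Limits of sets along an ultrafilter -/

section LimSet

variable {ι X : Type*} [TopologicalSpace X]

/-- The limit of the sets `Z j` along the ultrafilter `U`: the points all of whose neighbourhoods
meet `U`-almost all `Z j`. -/
def limSet (U : Ultrafilter ι) (Z : ι → Set X) : Set X :=
  {y | ∀ V ∈ 𝓝 y, ∀ᶠ j in U, (V ∩ Z j).Nonempty}

variable {U : Ultrafilter ι} {Z : ι → Set X}

theorem isClosed_limSet : IsClosed (limSet U Z) := by
  refine isClosed_of_closure_subset fun y hy V hV => ?_
  obtain ⟨W, hWV, hWo, hyW⟩ := mem_nhds_iff.1 hV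
  obtain ⟨z, hzW, hz⟩ := mem_closure_iff.1 hy W hWo hyW
  filter_upwards [hz W (hWo.mem_nhds hzW)] with j hj
  exact hj.mono (Set.inter_subset_inter_left _ hWV)

/-- If `K` misses the limit, each of its points has a neighbourhood missing `U`-almost all `Z j`.
Finitely many of these cover `K`, so `K` itself misses `U`-almost all `Z j`. -/
theorem inter_limSet_nonempty_iff [CompactSpace X] {K : Set X} (hK : IsClopen K) :
    (K ∩ limSet U Z).Nonempty ↔ ∀ᶠ j in U, (K ∩ Z j).Nonempty := by
  constructor
  · rintro ⟨y, hyK, hy⟩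
    exact hy K (hK.isOpen.mem_nhds hyK)
  · intro h
    by_contra hne
    have key : ∀ y ∈ K, ∃ V ∈ 𝓝 y, ∀ᶠ j in U, V ∩ Z j = ∅ := by
      intro y hy
      have : y ∉ limSet U Z := fun hy' => hne ⟨y, hy, hy'⟩
      simp only [limSet, Set.mem_ofPred_eq, not_forall] at this
      obtain ⟨V, hV, hVj⟩ := this
      refine ⟨V, hV, ?_⟩
      filter_upwards [Ultrafilter.eventually_not.2 hVj] with j hj
      exact Set.not_nonempty_iff_eq_empty.1 hj
    have : ∀ᶠ j in U, K ∩ Z j = ∅ := by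
      refine hK.isClosed.isCompact.induction_on (p := fun s => ∀ᶠ j in U, s ∩ Z j = ∅)
        (by simp) ?_ ?_ ?_
      · intro s t hst ht
        filter_upwards [ht] with j hj
        exact Set.subset_empty_iff.1 (hj ▸ Set.inter_subset_inter_left _ hst)
      · intro s t hs ht
        filter_upwards [hs, ht] with j hj hj'
        rw [Set.union_inter_distrib_right, hj, hj', Set.union_empty]
      · intro y hy
        obtain ⟨V, hV, hVj⟩ := key y hy
        exact ⟨V, mem_nhdsWithin_of_mem_nhds hV, hVj⟩
    obtain ⟨j, hj, hj'⟩ := (h.and this).exists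
    exact hj.ne_empty hj'

theorem image_limSet_eventuallyEq [CompactSpace X] {Q : Type*} [Finite Q] [TopologicalSpace Q]
    [DiscreteTopology Q] {g : X → Q} (hg : Continuous g) :
    ∀ᶠ j in U, g '' Z j = g '' limSet U Z := by
  have key : ∀ q, ∀ᶠ j in U, q ∈ g '' Z j ↔ q ∈ g '' limSet U Z := by
    intro q
    have hcl : IsClopen (g ⁻¹' {q}) := (isClopen_discrete {q}).preimage hg
    have hmem : ∀ s : Set X, q ∈ g '' s ↔ (g ⁻¹' {q} ∩ s).Nonempty := fun s =>
      ⟨fun ⟨x, hx, e⟩ => ⟨x, e, hx⟩, fun ⟨x, e, hx⟩ => ⟨x, hx, e⟩⟩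
    simp only [hmem]
    by_cases h : ∀ᶠ j in U, (g ⁻¹' {q} ∩ Z j).Nonempty
    · filter_upwards [h] with j hj
      exact iff_of_true hj ((inter_limSet_nonempty_iff hcl).2 h)
    · filter_upwards [Ultrafilter.eventually_not.2 h] with j hj
      exact iff_of_false hj fun h' => h ((inter_limSet_nonempty_iff hcl).1 h')
  filter_upwards [eventually_all.2 key] with j hj
  exact Set.ext hj

theorem mapsTo_limSet {f : X → X} (hf : Continuous f) (h : ∀ j, Set.MapsTo f (Z j) (Z j)) :
    Set.MapsTo f (limSet U Z) (limSet U Z) := by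
  intro y hy V hV
  filter_upwards [hy _ (hf.continuousAt hV)] with j hj
  obtain ⟨z, hzV, hz⟩ := hj
  exact ⟨f z, hzV, h j hz⟩

theorem limSet_nonempty [CompactSpace X] (h : ∀ j, (Z j).Nonempty) : (limSet U Z).Nonempty := by
  have := (inter_limSet_nonempty_iff (U := U) (Z := Z) isClopen_univ).2 (by simp [h])
  simpa using this

end LimSet

/-! ### Colourings of fixed point free homeomorphisms -/

section Coloring

/-- Colour `0` means uncoloured. Each `u` marks a set disjoint from its image under `T`, so its
uncoloured points can be coloured simultaneously, each avoiding the colours of its two neighbours `T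
x` and `T.symm x`; three genuine colours suffice. -/
theorem exists_partial_coloring (T : Cantor ≃ₜ Cantor) (l : List (Cantor → Bool))
    (hl : ∀ u ∈ l, Continuous u ∧ ∀ x, u x = true → u (T x) = false) :
    ∃ c : Cantor → Fin 4, Continuous c ∧ (∀ x, ∀ u ∈ l, u x = true → c x ≠ 0) ∧
      ∀ x, c x ≠ 0 → c (T x) ≠ c x := by
  induction l with
  | nil => exact ⟨fun _ => 0, continuous_const, by simp, by simp⟩
  | cons u l ih =>
    obtain ⟨c, hc, hcov, hcol⟩ := ih fun v hv => hl v (List.mem_cons_of_mem _ hv)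
    obtain ⟨hu, huT⟩ := hl u List.mem_cons_self
    have hfree : ∀ a b : Fin 4, ∃ q : Fin 4, q ≠ 0 ∧ q ≠ a ∧ q ≠ b := by decide
    choose p hp0 hpa hpb using hfree
    let F : Bool × Fin 4 × Fin 4 × Fin 4 → Fin 4 := fun t =>
      if t.1 = true ∧ t.2.1 = 0 then p t.2.2.1 t.2.2.2 else t.2.1
    have hF : Continuous F := continuous_of_discreteTopology
    refine ⟨fun x => F (u x, c x, c (T x), c (T.symm x)), by fun_prop, ?_, ?_⟩
    · intro x v hv hvx
      by_cases h : u x = true ∧ c x = 0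
      · simpa [F, h] using hp0 _ _
      · simp only [F, h, if_false]
        intro h0
        rcases List.mem_cons.1 hv with rfl | hv
        exacts [h ⟨hvx, h0⟩, hcov x v hv hvx h0]
    · intro x
      simp only [F, T.symm_apply_apply]
      by_cases h : u x = true ∧ c x = 0
      · have h' : ¬ (u (T x) = true ∧ c (T x) = 0) := by simp [huT x h.1]
        simp only [h', h, and_self, if_true, if_false]
        exact fun _ => (hpa _ _).symm
      · simp only [h, if_false]
        intro h0
        by_cases h' : u (T x) = true ∧ c (T x) = 0
        · simp only [h', and_self, if_true]
          exact hpb _ _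
        · simp only [h', if_false]
          exact hcol x h0

/-- A fixed point free homeomorphism of the Cantor set has a continuous colouring with four colours
that separates each point from its image. -/
theorem exists_coloring (T : Cantor ≃ₜ Cantor) (hT : ∀ x, T x ≠ x) :
    ∃ c : Cantor → (Fin 2 → Bool), Continuous c ∧ ∀ x, c (T x) ≠ c x := by
  obtain ⟨t, ht⟩ := isCompact_univ.elim_finite_subcover
    (fun i : ℕ => {x : Cantor | T x i ≠ x i})
    (fun i => isOpen_ne_fun (by fun_prop) (by fun_prop))
    (fun x _ => Set.mem_iUnion.2 (Function.ne_iff.1 (hT x)))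
  -- A point moved in coordinate `i` lies in the set marked by `(i, x i)`, and no marked set meets
  -- its image.
  let u : ℕ × Bool → Cantor → Bool := fun q x => decide (x q.1 = q.2 ∧ T x q.1 ≠ q.2)
  have hu : ∀ q, Continuous (u q) := fun q =>
    (continuous_of_discreteTopology
      (f := fun r : Bool × Bool => decide (r.1 = q.2 ∧ r.2 ≠ q.2))).comp
      (g := _) (f := fun x : Cantor => (x q.1, T x q.1)) (by fun_prop)
  obtain ⟨c, hc, hcov, hcol⟩ := exists_partial_coloring T
    ((t ×ˢ Finset.univ).toList.map u) (by
      simp only [List.mem_map]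
      rintro _ ⟨q, -, rfl⟩
      refine ⟨hu q, fun x hx => ?_⟩
      simp only [u, decide_eq_true_eq] at hx
      simp [u, hx.2])
  obtain ⟨e⟩ : Nonempty (Fin 4 ≃ (Fin 2 → Bool)) := Fintype.card_eq.1 (by simp)
  refine ⟨e ∘ c, (continuous_of_discreteTopology (f := e)).comp hc, fun x h => ?_⟩
  refine hcol x ?_ (e.injective h)
  obtain ⟨i, hi, hx⟩ := Set.mem_iUnion₂.1 (ht (Set.mem_univ x))
  refine hcov x (u (i, x i)) (List.mem_map_of_mem ?_) ?_
  · simpa using hi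
  · simpa [u] using hx

end Coloring

/-! ### Configuration families, Cauchy sequences and total boundedness -/

section Families

variable {Γ : Type*} [Group Γ] {S : Finset Γ}

instance finite_ball (S : Finset Γ) (r : ℕ) : Finite (ball S r) := by
  have h : Set.Finite {l : List S | l.length ≤ r} := List.finite_length_le S r
  refine Set.Finite.subset (h.image fun l => (l.map Subtype.val).prod) ?_
  rintro γ ⟨l, hl, hs, rfl⟩
  refine ⟨l.attachWith (· ∈ S) hs, by simpa using hl, ?_⟩
  simp

theorem exists_mem_ball (hsymm : ∀ s ∈ S, s⁻¹ ∈ S) (hgen : Subgroup.closure (S : Set Γ) = ⊤)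
    (γ : Γ) : ∃ n, γ ∈ ball S n := by
  have hγ : γ ∈ Subgroup.closure (S : Set Γ) := hgen ▸ Subgroup.mem_top γ
  have hS : (S : Set Γ) ∪ (S : Set Γ)⁻¹ = S :=
    Set.union_eq_left.2 fun s hs => by simpa using hsymm _ hs
  rw [← Subgroup.mem_toSubmonoid, Subgroup.closure_toSubmonoid, hS] at hγ
  obtain ⟨l, hl, rfl⟩ := Submonoid.exists_list_of_mem_closure hγ
  exact ⟨l.length, l, le_rfl, hl, rfl⟩

theorem countable_of_closure_eq_top (hsymm : ∀ s ∈ S, s⁻¹ ∈ S)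
    (hgen : Subgroup.closure (S : Set Γ) = ⊤) : Countable Γ := by
  refine Set.countable_univ_iff.1 ((Set.countable_iUnion fun n =>
    (Set.toFinite (ball S n)).countable).mono fun γ _ => ?_)
  exact Set.mem_iUnion.2 (exists_mem_ball hsymm hgen γ)

/-- Pad the labels with `false` up to `N` bits, realize the padded patterns on the larger ball, then
truncate the labels and restrict to the smaller ball. -/
theorem confFamily_subset_of_le {X X' : Type*} [TopologicalSpace X] [TopologicalSpace X']
    {a : Γ → X → X} {b : Γ → X' → X'} {n k N : ℕ} (hn : n ≤ N) (hk : k ≤ N)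
    (h : ConfFamily S a N N ⊆ ConfFamily S b N N) : ConfFamily S a n k ⊆ ConfFamily S b n k := by
  rintro A ⟨φ, hφ, rfl⟩
  let e : (Fin k → Bool) → (Fin N → Bool) := fun v i => if hi : i.1 < k then v ⟨i, hi⟩ else false
  let g : (Fin N → Bool) → (Fin k → Bool) := fun w i => w (Fin.castLE hk i)
  have hge : g ∘ e = id := by
    funext v i
    simp [g, e]
  obtain ⟨φ', hφ', hc⟩ := h ⟨e ∘ φ, (continuous_of_discreteTopology (f := e)).comp hφ, rfl⟩
  refine ⟨g ∘ φ', (continuous_of_discreteTopology (f := g)).comp hφ', ?_⟩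
  rw [conf_comp S b hn φ' g, hc, ← conf_comp S a hn (e ∘ φ) g, ← Function.comp_assoc, hge,
    Function.id_comp]

theorem confFamily_eq_of_le {X X' : Type*} [TopologicalSpace X] [TopologicalSpace X']
    {a : Γ → X → X} {b : Γ → X' → X'} {n k N : ℕ} (hn : n ≤ N) (hk : k ≤ N)
    (h : ConfFamily S a N N = ConfFamily S b N N) : ConfFamily S a n k = ConfFamily S b n k :=
  (confFamily_subset_of_le hn hk h.le).antisymm (confFamily_subset_of_le hn hk h.ge)

theorem confFamily_subset_of_conj {X X' : Type*} [TopologicalSpace X] [TopologicalSpace X']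
    {a : Γ → X → X} {b : Γ → X' → X'} (h : X ≃ₜ X') (hab : ∀ γ x, h (a γ x) = b γ (h x))
    (n k : ℕ) : ConfFamily S b n k ⊆ ConfFamily S a n k := by
  rintro A ⟨φ, hφ, rfl⟩
  refine ⟨φ ∘ h, hφ.comp h.continuous, ?_⟩
  have : pattern S a n (φ ∘ h) = pattern S b n φ ∘ h := by
    funext x γ
    simp [pattern, hab]
  rw [Conf, this, h.surjective.range_comp, Conf]

theorem CantorSubshift.IsConj.confFamily_eq {Y : CantorSubshift Γ} {β : FreeCantorAction Γ}
    (h : Y.IsConj β) (n k : ℕ) : ConfFamily S β.map n k = ConfFamily S Y.map n k := by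
  obtain ⟨e, he⟩ := h
  refine (confFamily_subset_of_conj e he n k).antisymm (confFamily_subset_of_conj e.symm ?_ n k)
  intro γ x
  rw [e.symm_apply_eq, he, e.apply_symm_apply]

open FreeCantorAction

theorem weakDist_lt_of_confFamily_eq {α β : FreeCantorAction Γ} {N : ℕ}
    (h : ConfFamily S α.map N N = ConfFamily S β.map N N) :
    weakDist S α β < (1 / 2 : ℝ) ^ N := by
  unfold weakDist
  split_ifs with hne
  · refine pow_lt_pow_right_of_lt_one₀ (by norm_num) (by norm_num) ?_
    by_contra hle
    exact (Nat.sInf_mem hne).2 (confFamily_eq_of_le (not_lt.1 hle) (not_lt.1 hle) h)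
  · positivity

theorem confFamily_eq_of_weakDist_lt {α β : FreeCantorAction Γ} {N : ℕ} (hN : 1 ≤ N)
    (h : weakDist S α β < (1 / 2 : ℝ) ^ N) :
    ConfFamily S α.map N N = ConfFamily S β.map N N := by
  by_contra hne
  exact (le_weakDist ⟨hN, hne⟩).not_gt h

theorem eventually_confFamily_eq {α : ℕ → FreeCantorAction Γ}
    (hα : CauchySeq fun j => cls S (α j)) (n k : ℕ) :
    ∃ J, ∀ i ≥ J, ∀ j ≥ J, ConfFamily S (α i).map n k = ConfFamily S (α j).map n k := by
  have hpos : (0 : ℝ) < (1 / 2 : ℝ) ^ (n + k + 1) := by positivity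
  obtain ⟨J, hJ⟩ := Metric.cauchySeq_iff.1 hα _ hpos
  refine ⟨J, fun i hi j hj => ?_⟩
  exact confFamily_eq_of_le (N := n + k + 1) (by omega) (by omega)
    (confFamily_eq_of_weakDist_lt (by omega) (hJ i hi j hj))

theorem surviving_of_frequently {α : ℕ → FreeCantorAction Γ}
    (hα : CauchySeq fun j => cls S (α j)) {n k : ℕ} {A : Set (ball S n → (Fin k → Bool))}
    (h : ∃ᶠ j in atTop, A ∈ ConfFamily S (α j).map n k) : Surviving S α n k A := by
  obtain ⟨J, hJ⟩ := eventually_confFamily_eq hα n k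
  obtain ⟨i, hi, hA⟩ := frequently_atTop.1 h J
  filter_upwards [eventually_ge_atTop J] with j hj
  exact hJ i hi j hj ▸ hA

theorem totallyBounded_free (S : Finset Γ) : TotallyBounded (Set.univ : Set (Free S)) := by
  refine Metric.totallyBounded_of_finite_discretization fun ε hε => ?_
  obtain ⟨N, hN⟩ := exists_pow_lt_of_lt_one hε (show (1 / 2 : ℝ) < 1 by norm_num)
  refine ⟨Set (Set (ball S N → (Fin N → Bool))), Fintype.ofFinite _,
    fun x => ConfFamily S (Quotient.out (s := weakSetoid S) x.1).map N N, ?_⟩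
  rintro ⟨x, _⟩ ⟨y, _⟩ h
  have hxy := weakDist_lt_of_confFamily_eq h
  have hd : dist x y = weakDist S (Quotient.out (s := weakSetoid S) x)
      (Quotient.out (s := weakSetoid S) y) := by
    conv_lhs => rw [← Quotient.out_eq (s := weakSetoid S) x, ← Quotient.out_eq (s := weakSetoid S) y]
    rfl
  exact hd ▸ hxy.trans hN

end Families

/-! ### Labellings that split every atom -/

section Encoding

/-- A continuous map from the Cantor set to a discrete space depends on finitely many
coordinates. -/
theorem exists_modulus {Q : Type*} [TopologicalSpace Q] [DiscreteTopology Q] {F : Cantor → Q}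
    (hF : Continuous F) : ∃ M, ∀ x x' : Cantor, (∀ i < M, x' i = x i) → F x' = F x := by
  suffices ∃ M, ∀ x ∈ (Set.univ : Set Cantor), ∀ x' : Cantor, (∀ i < M, x' i = x i) →
      F x' = F x by simpa using this
  refine isCompact_univ.induction_on
    (p := fun s => ∃ M, ∀ x ∈ s, ∀ x' : Cantor, (∀ i < M, x' i = x i) → F x' = F x)
    ⟨0, by simp⟩ ?_ ?_ ?_
  · rintro s t hst ⟨M, hM⟩
    exact ⟨M, fun x hx => hM x (hst hx)⟩
  · rintro s t ⟨M, hM⟩ ⟨N, hN⟩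
    refine ⟨max M N, fun x hx x' h => ?_⟩
    rcases hx with hx | hx
    · exact hM x hx x' fun i hi => h i (lt_max_of_lt_left hi)
    · exact hN x hx x' fun i hi => h i (lt_max_of_lt_right hi)
  · intro x _
    obtain ⟨n, hn⟩ := exists_cylinder_subset
      (hF.continuousAt (x := x) ((isOpen_discrete {F x}).mem_nhds rfl))
    refine ⟨_, mem_nhdsWithin_of_mem_nhds (cylinder_mem_nhds x n), n, fun y hy x' h => ?_⟩
    have h₁ : F y = F x := hn y hy
    have h₂ : F x' = F x := hn x' fun i hi => (h i hi).trans (hy i hi)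
    rw [h₁, h₂]

variable {Γ : Type*} [Group Γ] {S : Finset Γ}

theorem FreeCantorAction.continuous_map (α : FreeCantorAction Γ) (γ : Γ) :
    Continuous (α.map γ) := (α.act γ).continuous

theorem FreeCantorAction.map_one (α : FreeCantorAction Γ) (x : Cantor) : α.map 1 x = x := by
  simp [FreeCantorAction.map]

theorem FreeCantorAction.map_mul (α : FreeCantorAction Γ) (γ δ : Γ) (x : Cantor) :
    α.map (γ * δ) x = α.map γ (α.map δ x) := by
  simp [FreeCantorAction.map]

/-- Interleave a sequence of labellings `b` with further labellings, at the odd places, such that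
for `m ≤ r` the labelling `2 * m + 1` takes both values on each atom of the partition given by the
translates by `ball S r` of the labellings before `2 * m`. -/
theorem exists_splitting_encoding (S : Finset Γ) (α : FreeCantorAction Γ)
    (b : ℕ → Cantor → Bool) (hb : ∀ i, Continuous (b i)) (r : ℕ) :
    ∃ Φ : Cantor → Cantor, Continuous Φ ∧ (∀ i x, Φ x (2 * i) = b i x) ∧
      ∀ m ≤ r, ∀ x c, ∃ x', Φ x' (2 * m + 1) = c ∧
        ∀ γ ∈ ball S r, ∀ i < 2 * m, Φ (α.map γ x') i = Φ (α.map γ x) i := by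
  have hmod : ∀ N, ∃ M, N ≤ M ∧ ∀ x x' : Cantor, (∀ i < M, x' i = x i) → ∀ γ ∈ ball S r,
      (∀ i < r, b i (α.map γ x') = b i (α.map γ x)) ∧
      ∀ i < N, α.map γ x' i = α.map γ x i := by
    intro N
    have hF : Continuous fun (x : Cantor) (γ : ball S r) =>
        ((fun i : Fin r => b i (α.map γ x)), fun i : Fin N => α.map γ x i) := by
      refine continuous_pi fun γ => Continuous.prodMk (continuous_pi fun i => ?_)
        (continuous_pi fun i => ?_)
      · exact (hb i).comp (α.continuous_map γ)
      · exact (continuous_apply _).comp (α.continuous_map γ)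
    obtain ⟨M, hM⟩ := exists_modulus hF
    refine ⟨max N M, le_max_left _ _, fun x x' h γ hγ => ?_⟩
    have := congrFun (hM x x' fun i hi => h i (lt_max_of_lt_right hi)) ⟨γ, hγ⟩
    obtain ⟨h₁, h₂⟩ := Prod.ext_iff.1 this
    exact ⟨fun i hi => congrFun h₁ ⟨i, hi⟩, fun i hi => congrFun h₂ ⟨i, hi⟩⟩
  choose h hle hh using hmod
  -- The first `f (m + 1)` bits of `x` determine, on all translates by the ball, the labels `b i`
  -- for `i < r` and the coordinates up to `f m`. Changing bit `f (m + 1)` is therefore invisible to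
  -- all earlier labels.
  let f : ℕ → ℕ := fun m => Nat.rec 0 (fun _ a => h (a + 1)) m
  have hf : ∀ m, f (m + 1) = h (f m + 1) := fun m => rfl
  have hfm : StrictMono f := strictMono_nat_of_lt_succ fun m => hf m ▸ hle (f m + 1)
  let Φ : Cantor → Cantor := fun x n => if n % 2 = 0 then b (n / 2) x else x (f (n / 2))
  have hodd : ∀ m x, Φ x (2 * m + 1) = x (f m) := by
    intro m x
    have h₁ : (2 * m + 1) % 2 ≠ 0 := by omega
    have h₂ : (2 * m + 1) / 2 = m := by omega
    simp only [Φ, h₁, h₂, if_false]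
  have heven : ∀ i x, Φ x (2 * i) = b i x := by
    intro i x
    simp [Φ]
  refine ⟨Φ, continuous_pi fun n => ?_, heven, ?_⟩
  · by_cases hn : n % 2 = 0
    · simpa only [Φ, hn, if_true] using hb _
    · simpa only [Φ, hn, if_false] using continuous_apply _
  · intro m hm x c
    refine ⟨Function.update x (f m) c, by simp [hodd], fun γ hγ i hi => ?_⟩
    -- For `m = 0` there is no `i < 2 * m` to check.
    obtain ⟨m, rfl⟩ : ∃ l, m = l + 1 := ⟨m - 1, by omega⟩
    obtain ⟨hbase, hid⟩ := hh (f m + 1) x (Function.update x (f (m + 1)) c)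
      (fun i hi => Function.update_of_ne (by rw [hf]; exact hi.ne) _ _) γ hγ
    rcases Nat.even_or_odd' i with ⟨l, rfl | rfl⟩
    · rw [heven, heven]
      exact hbase l (by omega)
    · rw [hodd, hodd]
      exact hid _ (Nat.lt_succ_of_le (hfm.monotone (by omega)))

end Encoding

/-! ### The limit subshift -/

section Limit

variable {Γ : Type*} [Group Γ] {S : Finset Γ}

theorem continuous_shift (δ : Γ) : Continuous (shift δ : (Γ → Cantor) → (Γ → Cantor)) :=
  continuous_pi fun γ => continuous_apply (γ * δ)

theorem exists_ball_cylinder_subset (hball : ∀ γ : Γ, ∃ n, γ ∈ ball S n) {y : Γ → Cantor}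
    {V : Set (Γ → Cantor)} (hV : V ∈ 𝓝 y) :
    ∃ m, ∀ z : Γ → Cantor, (∀ γ ∈ ball S m, ∀ i < 2 * m, z γ i = y γ i) → z ∈ V := by
  rw [nhds_pi, Filter.mem_pi] at hV
  obtain ⟨I, hI, t, ht, htV⟩ := hV
  choose n hn using fun γ => exists_cylinder_subset (ht γ)
  choose l hl using hball
  refine ⟨hI.toFinset.sup fun γ => n γ + l γ, fun z hz => htV fun γ hγ => hn γ _ fun i hi => ?_⟩
  have hle : n γ + l γ ≤ hI.toFinset.sup fun γ => n γ + l γ :=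
    Finset.le_sup (f := fun γ => n γ + l γ) (hI.mem_toFinset.2 hγ)
  exact hz γ (ball_mono S (by omega) (hl γ)) i (by omega)

/-- The subshift factor of the action `α` given by the labelling `Φ`. -/
def itinerary (α : FreeCantorAction Γ) (Φ : Cantor → Cantor) (x : Cantor) : Γ → Cantor :=
  fun γ => Φ (α.map γ x)

theorem continuous_itinerary (α : FreeCantorAction Γ) {Φ : Cantor → Cantor} (hΦ : Continuous Φ) :
    Continuous (itinerary α Φ) :=
  continuous_pi fun γ => hΦ.comp (α.continuous_map γ)

theorem shift_itinerary (α : FreeCantorAction Γ) (Φ : Cantor → Cantor) (δ : Γ) (x : Cantor) :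
    shift δ (itinerary α Φ x) = itinerary α Φ (α.map δ x) := by
  funext γ
  simp only [shift, itinerary, α.map_mul]

/-- The shift on the limit along `U` of the subshift factors of `α j` given by `Φ j`. -/
def limShift (U : Ultrafilter ℕ) (α : ℕ → FreeCantorAction Γ) (Φ : ℕ → Cantor → Cantor)
    (δ : Γ) (y : limSet U fun j => Set.range (itinerary (α j) (Φ j))) :
    limSet U fun j => Set.range (itinerary (α j) (Φ j)) :=
  ⟨shift δ y, mapsTo_limSet (continuous_shift δ) (by
    rintro j _ ⟨x, rfl⟩
    exact ⟨_, (shift_itinerary _ _ _ _).symm⟩) y.2⟩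

variable {U : Ultrafilter ℕ} {α : ℕ → FreeCantorAction Γ} {Φ : ℕ → Cantor → Cantor}

/-- A configuration set is the image of the subshift under a continuous map into the finite set of
patterns, so `image_limSet_eventuallyEq` applies. -/
theorem conf_limShift_eventuallyEq {Q : Type*} [Finite Q] [TopologicalSpace Q]
    [DiscreteTopology Q] {g : (Γ → Cantor) → Q} (hg : Continuous g) (n : ℕ) :
    ∀ᶠ j in U, Conf S (α j).map n (g ∘ itinerary (α j) (Φ j)) =
      Conf S (limShift U α Φ) n fun y => g y := by
  have hG : Continuous fun (y : Γ → Cantor) (γ : ball S n) => g (shift γ.1 y) :=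
    continuous_pi fun γ => hg.comp (continuous_shift _)
  filter_upwards [image_limSet_eventuallyEq (U := U)
    (Z := fun j => Set.range (itinerary (α j) (Φ j))) hG] with j hj
  have h₁ : Conf S (α j).map n (g ∘ itinerary (α j) (Φ j)) =
      (fun (y : Γ → Cantor) (γ : ball S n) => g (shift γ.1 y)) ''
        Set.range (itinerary (α j) (Φ j)) := by
    rw [← Set.range_comp, Conf]
    congr 1
    funext x γ
    simp only [pattern, Function.comp, shift_itinerary]
  rw [h₁, hj, Set.image_eq_range]
  rfl

/-- A labelling of the limit says nothing about the approximating subshifts until it is extended to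
the whole of `Cantor^Γ`, which the retraction does. -/
theorem confFamily_limShift_subset [Countable Γ] (hU : (U : Filter ℕ) ≤ atTop)
    (hα : CauchySeq fun j => cls S (α j)) (hΦ : ∀ j, Continuous (Φ j)) {n k : ℕ}
    {A : Set (ball S n → (Fin k → Bool))} (hA : A ∈ ConfFamily S (limShift U α Φ) n k) :
    Surviving S α n k A := by
  obtain ⟨φ, hφ, rfl⟩ := hA
  obtain ⟨r, hr, hrid⟩ := exists_retraction_of_pi (isClosed_limSet (U := U)
    (Z := fun j => Set.range (itinerary (α j) (Φ j))))
    (limSet_nonempty fun j => Set.range_nonempty _)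
  refine surviving_of_frequently hα (Frequently.filter_mono (Eventually.frequently ?_) hU)
  filter_upwards [conf_limShift_eventuallyEq (S := S) (U := U) (α := α) (Φ := Φ) (hφ.comp hr) n]
    with j hj
  refine ⟨_, (hφ.comp hr).comp (continuous_itinerary (α j) (hΦ j)), hj.trans ?_⟩
  simp [hrid]

theorem mem_confFamily_limShift {n k : ℕ} {A : Set (ball S n → (Fin k → Bool))} (t : Fin k → ℕ)
    (h : ∀ᶠ j in U, Conf S (α j).map n (fun x i => Φ j x (t i)) = A) :
    A ∈ ConfFamily S (limShift U α Φ) n k := by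
  have hg : Continuous fun (y : Γ → Cantor) (i : Fin k) => y 1 (t i) := by fun_prop
  obtain ⟨j, hj, hA⟩ := ((conf_limShift_eventuallyEq (S := S) (α := α) (Φ := Φ) hg n).and h).exists
  refine ⟨_, hg.comp continuous_subtype_val, hj.symm.trans (Eq.trans ?_ hA)⟩
  congr 1
  funext x i
  simp only [Function.comp, itinerary, (α j).map_one]

theorem limSet_perfect (hball : ∀ γ : Γ, ∃ n, γ ∈ ball S n) (hU : (U : Filter ℕ) ≤ atTop)
    (hsplit : ∀ j, ∀ m ≤ j, ∀ x c, ∃ x', Φ j x' (2 * m + 1) = c ∧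
        ∀ γ ∈ ball S j, ∀ i < 2 * m, Φ j ((α j).map γ x') i = Φ j ((α j).map γ x) i)
    {y : Γ → Cantor} (hy : y ∈ limSet U fun j => Set.range (itinerary (α j) (Φ j)))
    {V : Set (Γ → Cantor)} (hV : V ∈ 𝓝 y) :
    ∃ z ∈ limSet U fun j => Set.range (itinerary (α j) (Φ j)), z ≠ y ∧ z ∈ V := by
  obtain ⟨m, hm⟩ := exists_ball_cylinder_subset hball hV
  let P : (Γ → Cantor) → (ball S m → Fin (2 * m) → Bool) := fun z γ i => z γ i
  have hP : Continuous P := by fun_prop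
  have hP' : Continuous fun z : Γ → Cantor => (P z, z 1 (2 * m + 1)) := by fun_prop
  -- The clopen condition is to agree with `y` on the given window and to differ from it in the odd
  -- coordinate `2 * m + 1` at the unit. By `hsplit`, the subshifts near `y` with `j ≥ m` contain
  -- such points.
  obtain ⟨z, hzW, hz⟩ := (inter_limSet_nonempty_iff (U := U)
    (Z := fun j => Set.range (itinerary (α j) (Φ j)))
    ((isClopen_discrete {(P y, !y 1 (2 * m + 1))}).preimage hP')).2 (by
      filter_upwards [hU (eventually_ge_atTop m),
        hy _ (hP.continuousAt ((isOpen_discrete {P y}).mem_nhds rfl))] with j hmj hj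
      obtain ⟨_, hW, x, rfl⟩ := hj
      obtain ⟨x', hx', hag⟩ := hsplit j m hmj x (!y 1 (2 * m + 1))
      refine ⟨itinerary (α j) (Φ j) x', Prod.ext ?_ ?_, x', rfl⟩
      · refine Eq.trans ?_ hW
        funext γ i
        exact hag γ (ball_mono S hmj γ.2) i i.2
      · simpa only [itinerary, (α j).map_one] using hx')
  obtain ⟨hz₁, hz₂⟩ := Prod.ext_iff.1 (Set.mem_singleton_iff.1 hzW)
  refine ⟨z, hz, ?_, hm z fun γ hγ i hi => congrFun (congrFun hz₁ ⟨γ, hγ⟩) ⟨i, hi⟩⟩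
  rintro rfl
  simp at hz₂

/-- Freeness passes from an action to every action that has its configuration sets. -/
theorem eq_one_of_fixed {X : Type*} [TopologicalSpace X] {a : Γ → X → X} (ha : ∀ x, a 1 x = x)
    (β : FreeCantorAction Γ) {n : ℕ} (h : ConfFamily S β.map n 2 ⊆ ConfFamily S a n 2)
    {δ : Γ} (hδ : δ ∈ ball S n) {y : X} (hy : a δ y = y) : δ = 1 := by
  by_contra hne
  obtain ⟨c, hc, hcol⟩ := exists_coloring (β.act δ) fun x hx => hne (β.free δ x hx)
  obtain ⟨φ, -, hφ⟩ := h ⟨c, hc, rfl⟩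
  -- The pattern at a point fixed by `δ` has equal colours at `1` and `δ`; it also occurs in the
  -- colouring `c`, which forbids this.
  obtain ⟨x, hx⟩ : pattern S a n φ y ∈ Conf S β.map n c := hφ ▸ Set.mem_range_self y
  refine hcol x ?_
  have h₁ := congrFun hx ⟨δ, hδ⟩
  have h₂ := congrFun hx ⟨1, one_mem_ball S n⟩
  simp only [pattern, hy, ha, β.map_one] at h₁ h₂
  exact h₁.trans h₂.symm

theorem exists_cantorSubshift (hsymm : ∀ s ∈ S, s⁻¹ ∈ S)
    (hgen : Subgroup.closure (S : Set Γ) = ⊤) (hα : CauchySeq fun j => cls S (α j)) :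
    ∃ Y : CantorSubshift Γ, ∀ (n k : ℕ) (A : Set (ball S n → (Fin k → Bool))),
      A ∈ ConfFamily S Y.map n k ↔ Surviving S α n k A := by
  have hball := exists_mem_ball hsymm hgen
  have := countable_of_closure_eq_top hsymm hgen
  let U : Ultrafilter ℕ := hyperfilter ℕ
  have hU : (U : Filter ℕ) ≤ atTop := Nat.hyperfilter_le_atTop
  -- One index for each bit of each potential configuration set; this is countable because balls are
  -- finite.
  let ι := Σ p : ℕ × ℕ, Set (ball S p.1 → (Fin p.2 → Bool)) × Fin p.2
  have : Nonempty ι := ⟨⟨(0, 1), ∅, 0⟩⟩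
  obtain ⟨s, hs⟩ := exists_surjective_nat ι
  have hψ : ∀ (j n k : ℕ) (A : Set (ball S n → (Fin k → Bool))),
      ∃ ψ : Cantor → (Fin k → Bool), Continuous ψ ∧
        (A ∈ ConfFamily S (α j).map n k → Conf S (α j).map n ψ = A) := by
    intro j n k A
    by_cases hA : A ∈ ConfFamily S (α j).map n k
    · obtain ⟨ψ, hψ, e⟩ := hA
      exact ⟨ψ, hψ, fun _ => e⟩
    -- If `A` is not realized by `α j`, any labelling will do; for surviving `A` this affects only
    -- finitely many `j`.
    · exact ⟨fun _ _ => false, continuous_const, fun h => absurd h hA⟩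
  choose ψ hψc hψA using hψ
  let b : ℕ → ι → Cantor → Bool := fun j t x => ψ j t.1.1 t.1.2 t.2.1 x t.2.2
  have hb : ∀ j t, Continuous (b j t) := fun j t => (continuous_apply _).comp (hψc _ _ _ _)
  choose Φ hΦ hbase hsplit using fun j =>
    exists_splitting_encoding S (α j) (fun i => b j (s i)) (fun i => hb j (s i)) j
  have key : ∀ (n k : ℕ) (A : Set (ball S n → (Fin k → Bool))),
      A ∈ ConfFamily S (limShift U α Φ) n k ↔ Surviving S α n k A := by
    refine fun n k A => ⟨confFamily_limShift_subset hU hα hΦ, fun hA => ?_⟩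
    choose t ht using fun i : Fin k => hs ⟨(n, k), A, i⟩
    refine mem_confFamily_limShift (fun i => 2 * t i) ?_
    filter_upwards [hU hA] with j hj
    refine Eq.trans ?_ (hψA j n k A hj)
    congr 1
    funext x i
    rw [hbase, ht]
  refine ⟨{
    carrier := limSet U fun j => Set.range (itinerary (α j) (Φ j))
    isClosed := isClosed_limSet
    shift_mem := fun δ y hy => (limShift U α Φ δ ⟨y, hy⟩).2
    homeo := nonempty_homeomorph_cantor_of_pi isClosed_limSet
      (limSet_nonempty fun j => Set.range_nonempty _)
      fun y hy V hV => limSet_perfect hball hU hsplit hy hV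
    free := ?_ }, key⟩
  intro δ y hy hδy
  obtain ⟨n, hn⟩ := hball δ
  -- From `J` on the families at `(n, 2)` agree, so every configuration set of `α J` there survives.
  -- Two bits encode the four colours.
  obtain ⟨J, hJ⟩ := eventually_confFamily_eq hα n 2
  refine eq_one_of_fixed (a := limShift U α Φ) (y := ⟨y, hy⟩) (fun z => Subtype.ext ?_) (α J) ?_ hn
    (Subtype.ext hδy)
  · funext γ
    simp [limShift, shift]
  · intro A hA
    refine (key n 2 A).2 ?_
    filter_upwards [eventually_ge_atTop J] with j hj
    exact hJ J le_rfl j hj ▸ hA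

theorem CantorSubshift.exists_isConj (Y : CantorSubshift Γ) :
    ∃ β : FreeCantorAction Γ, Y.IsConj β := by
  obtain ⟨h⟩ := Y.homeo
  have hmul : ∀ (γ δ : Γ) (y : Y.carrier), Y.map (γ * δ) y = Y.map γ (Y.map δ y) := by
    intro γ δ y
    refine Subtype.ext (funext fun ε => ?_)
    simp only [CantorSubshift.map, shift, mul_assoc]
  have hone : ∀ y : Y.carrier, Y.map 1 y = y := by
    intro y
    refine Subtype.ext (funext fun ε => ?_)
    simp only [CantorSubshift.map, shift, mul_one]
  have hcont : ∀ δ, Continuous (Y.map δ) := fun δ =>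
    ((continuous_shift δ).comp continuous_subtype_val).subtype_mk _
  let F : Γ → (Cantor ≃ₜ Cantor) := fun δ => {
    toFun := fun x => h (Y.map δ (h.symm x))
    invFun := fun x => h (Y.map δ⁻¹ (h.symm x))
    left_inv := fun x => by simp [← hmul, hone]
    right_inv := fun x => by simp [← hmul, hone]
    continuous_toFun := h.continuous.comp ((hcont δ).comp h.symm.continuous)
    continuous_invFun := h.continuous.comp ((hcont δ⁻¹).comp h.symm.continuous) }
  have hF : ∀ δ x, F δ x = h (Y.map δ (h.symm x)) := fun _ _ => rfl
  refine ⟨{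
    act := {
      toFun := F
      map_one' := by ext1 x; simp [hF, hone]
      map_mul' := fun γ δ => by ext1 x; simp [hF, hmul] }
    free := fun γ x hx => ?_ }, h, fun δ y => ?_⟩
  · have hx' : Y.map γ (h.symm x) = h.symm x := by
      rw [h.eq_symm_apply]
      exact hx
    exact Y.free γ _ (h.symm x).2 (congrArg Subtype.val hx')
  · change _ = h (Y.map δ (h.symm (h y)))
    rw [h.symm_apply_apply]

/-- At each level the families of the sequence are eventually constant, and the surviving sets are
exactly the members of that constant family. -/
theorem tendsto_cls_of_confFamily_eq {β : FreeCantorAction Γ}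
    (hα : CauchySeq fun j => cls S (α j))
    (h : ∀ (n k : ℕ) (A : Set (ball S n → (Fin k → Bool))),
      A ∈ ConfFamily S β.map n k ↔ Surviving S α n k A) :
    Tendsto (fun j => cls S (α j)) atTop (𝓝 (cls S β)) := by
  refine Metric.tendsto_atTop.2 fun ε hε => ?_
  obtain ⟨N, hN⟩ := exists_pow_lt_of_lt_one hε (show (1 / 2 : ℝ) < 1 by norm_num)
  obtain ⟨J, hJ⟩ := eventually_confFamily_eq hα N N
  refine ⟨J, fun j hj => (weakDist_lt_of_confFamily_eq (S := S) ?_).trans hN⟩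
  ext A
  rw [h]
  constructor
  · intro hA
    filter_upwards [eventually_ge_atTop J] with i hi
    exact hJ j hj i hi ▸ hA
  · intro hA
    obtain ⟨i, hi, hi'⟩ := (hA.and (eventually_ge_atTop J)).exists
    exact hJ i hi' j hj ▸ hi

theorem exists_limit (hsymm : ∀ s ∈ S, s⁻¹ ∈ S) (hgen : Subgroup.closure (S : Set Γ) = ⊤)
    (hα : CauchySeq fun j => cls S (α j)) :
    ∃ (Y : CantorSubshift Γ) (β : FreeCantorAction Γ), Y.IsConj β ∧
      Tendsto (fun j => cls S (α j)) atTop (𝓝 (cls S β)) ∧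
      ∀ (n k : ℕ) (A : Set (ball S n → (Fin k → Bool))),
        A ∈ ConfFamily S Y.map n k ↔ Surviving S α n k A := by
  obtain ⟨Y, hY⟩ := exists_cantorSubshift hsymm hgen hα
  obtain ⟨β, hβ⟩ := Y.exists_isConj
  refine ⟨Y, β, hβ, tendsto_cls_of_confFamily_eq hα fun n k A => ?_, hY⟩
  rw [hβ.confFamily_eq, hY]

open FreeCantorAction in
theorem compactSpace_free (hsymm : ∀ s ∈ S, s⁻¹ ∈ S)
    (hgen : Subgroup.closure (S : Set Γ) = ⊤) : CompactSpace (Free S) := by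
  have : CompleteSpace (Free S) := by
    refine Metric.complete_of_cauchySeq_tendsto fun u hu => ?_
    have hout : ∀ x : Free S, cls S (Quotient.out (s := weakSetoid S) x) = x := fun x =>
      Quotient.out_eq (s := weakSetoid S) x
    obtain ⟨-, β, -, hβ, -⟩ := exists_limit (S := S)
      (α := fun j => Quotient.out (s := weakSetoid S) (u j)) hsymm hgen
      (by simpa only [hout] using hu)
    exact ⟨cls S β, by simpa only [hout] using hβ⟩
  exact ⟨isCompact_iff_totallyBounded_isComplete.2 ⟨totallyBounded_free S, isComplete_univ⟩⟩

end Limit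

end QualWeak

open QualWeak in
theorem mainTheorem2 {Γ : Type*} [Group Γ] (S : Finset Γ)
    (hsymm : ∀ s ∈ S, s⁻¹ ∈ S) (hgen : Subgroup.closure (S : Set Γ) = ⊤) :
    CompactSpace (Free S) ∧
    ∀ α : ℕ → FreeCantorAction Γ, CauchySeq (fun j => cls S (α j)) →
      ∃ (Y : CantorSubshift Γ) (β : FreeCantorAction Γ), Y.IsConj β ∧
        Tendsto (fun j => cls S (α j)) atTop (𝓝 (cls S β)) ∧
        ∀ n k : ℕ, 1 ≤ n → 1 ≤ k → ∀ A : Set (ball S n → (Fin k → Bool)),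
          A ∈ ConfFamily S Y.map n k ↔ Surviving S α n k A := by
  refine ⟨compactSpace_free hsymm hgen, fun α hα => ?_⟩
  obtain ⟨Y, β, hconj, hlim, hconf⟩ := exists_limit hsymm hgen hα
  exact ⟨Y, β, hconj, hlim, fun n k _ _ A => hconf n k A⟩
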